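/- A \emph{Tarski structure} is a nonempty set of points with a ternary relation $B$ of betweenness and a quaternary relation of congruence, written $ab\equiv cd$. Let $\mathrm{CE}_2'$ be the collection of the following ten axioms about such a structure, in which lower-case variables range over points, and $X,Y$ in (Co) range over all sets of points: \begin{itemize} \item (TE) $\forall a,b,p,q,r,s:\ ab\equiv pq\wedge ab\equiv rs\to pq\equiv rs$; \item (IE) $\forall a,b,c:\ ab\equiv cc\to a=b$; \item (SC) $\forall a,b,c,q\ \exists x:\ B\,qax\wedge ax\equiv bc$; \item (FS$'$) $\forall a,b,c,d,a',b',c',d':\ a\ne b\wedge B\,abc\wedge B\,a'b'c'\wedge ab\equiv a'b'\wedge bc\equiv b'c'\wedge ad\equiv a'd'\wedge bd\equiv b'd'\to dc\equiv c'd'$; \item (IB) $\forall a,b:\ B\,aba\to a=b$; \item (Pa) $\forall a,b,c,p,q:\ B\,apc\wedge B\,bqc\to\exists x:\ B\,pxb\wedge B\,qxa$; \item (Lo$_2$) $\exists a,b,c:\ \neg B\,abc\wedge\neg B\,bca\wedge\neg B\,cab$; \item (Up$_2$) $\forall a,b,c,p,q:\ p\ne q\wedge ap\equiv aq\wedge bp\equiv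 bq\wedge cp\equiv cq\to B\,abc\vee B\,bca\vee B\,cab$; \item (Eu) $\forall a,b,c,d,t:\ B\,adt\wedge B\,bdc\wedge a\ne d\to\exists x,y:\ B\,abx\wedge B\,acy\wedge B\,xty$; \item (Co) $\forall X,Y:\ \bigl(\exists a\,\forall x,y:\ x\in X\wedge y\in Y\to B\,axy\bigr)\to\bigl(\exists b\,\forall x,y:\ x\in X\wedge y\in Y\to B\,xby\bigr)$. \end{itemize} An axiom of $\mathrm{CE}_2'$ is \emph{independent in $\mathrm{CE}_2'$} if it is not a consequence of the other nine, that is, if there is a Tarski structure in which the other nine axioms hold and it fails. \textbf{Corollary.} Each of the six axioms (SC), (IB), (Lo$_2$), (Up$_2$), (Eu) and (Co) is individually independent in $\mathrm{CE}_2'$. -/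

import Mathlib

/-- A structure for the language of Tarski's geometry on a set `P` of points: an arbitrary ternary
relation of betweenness and an arbitrary quaternary relation of congruence. `B a b c` is read
"`b` lies on the segment from `a` to `c`", and `Cong a b c d` is read "the segment from `a` to `b`
is congruent to the segment from `c` to `d`". -/
structure TarskiStructure (P : Type) where
  B : P → P → P → Prop
  Cong : P → P → P → P → Prop

namespace TarskiStructure

variable {P : Type} (M : TarskiStructure P)

/-- Transitivity for equidistance. -/
def TE : Prop :=
  ∀ a b p q r s : P, M.Cong a b p q ∧ M.Cong a b r s → M.Cong p q r s

/-- Identity for equidistance. -/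
def IE : Prop :=
  ∀ a b c : P, M.Cong a b c c → a = b

/-- Segment construction. -/
def SC : Prop :=
  ∀ a b c q : P, ∃ x : P, M.B q a x ∧ M.Cong a x b c

/-- The modified five-segments sentence: its conclusion is `dc ≡ c'd'`, not `cd ≡ c'd'`. -/
def FS' : Prop :=
  ∀ a b c d a' b' c' d' : P,
    a ≠ b ∧ M.B a b c ∧ M.B a' b' c' ∧
      M.Cong a b a' b' ∧ M.Cong b c b' c' ∧ M.Cong a d a' d' ∧ M.Cong b d b' d' →
    M.Cong d c c' d'

/-- Identity for betweenness. -/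
def IB : Prop :=
  ∀ a b : P, M.B a b a → a = b

/-- Pasch. -/
def Pa : Prop :=
  ∀ a b c p q : P, M.B a p c ∧ M.B b q c → ∃ x : P, M.B p x b ∧ M.B q x a

/-- Lower 2-dimensional sentence. -/
def Lo₂ : Prop :=
  ∃ a b c : P, ¬ M.B a b c ∧ ¬ M.B b c a ∧ ¬ M.B c a b

/-- Upper 2-dimensional sentence. -/
def Up₂ : Prop :=
  ∀ a b c p q : P,
    p ≠ q ∧ M.Cong a p a q ∧ M.Cong b p b q ∧ M.Cong c p c q →
    M.B a b c ∨ M.B b c a ∨ M.B c a b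

/-- The Euclidean sentence. -/
def Eu : Prop :=
  ∀ a b c d t : P, M.B a d t ∧ M.B b d c ∧ a ≠ d →
    ∃ x y : P, M.B a b x ∧ M.B a c y ∧ M.B x t y

/-- Continuity, a second-order sentence: `X` and `Y` range over all sets of points. -/
def Co : Prop :=
  ∀ X Y : Set P,
    (∃ a : P, ∀ x y : P, x ∈ X ∧ y ∈ Y → M.B a x y) →
    (∃ b : P, ∀ x y : P, x ∈ X ∧ y ∈ Y → M.B x b y)

end TarskiStructure

/-- Labels for the sentences, so that removing one from a collection removes exactly that one. -/
inductive TarskiAx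
  | TE | IE | SC | FS' | IB | Pa | Lo₂ | Up₂ | Eu | Co

/-- The sentence with a given label holds in the structure `M`. -/
def TarskiAx.HoldsIn {P : Type} (M : TarskiStructure P) : TarskiAx → Prop
  | .TE => M.TE
  | .IE => M.IE
  | .SC => M.SC
  | .FS' => M.FS'
  | .IB => M.IB
  | .Pa => M.Pa
  | .Lo₂ => M.Lo₂
  | .Up₂ => M.Up₂
  | .Eu => M.Eu
  | .Co => M.Co

/-- The collection CE₂′ (the continuous Euclidean plane). -/
def CE₂' : Set TarskiAx :=
  {.TE, .IE, .SC, .FS', .IB, .Pa, .Lo₂, .Up₂, .Eu, .Co}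

/-- `Γ` entails `φ`: every structure with a nonempty set of points in which all members of `Γ` hold
is one in which `φ` holds. -/
def TarskiAx.Entails (Γ : Set TarskiAx) (φ : TarskiAx) : Prop :=
  ∀ (P : Type) [Nonempty P] (M : TarskiStructure P), (∀ ψ ∈ Γ, ψ.HoldsIn M) → φ.HoldsIn M

/-- `φ` is independent in `Γ`: it is a member of `Γ` and does not follow from the others. -/
def TarskiAx.IndependentIn (φ : TarskiAx) (Γ : Set TarskiAx) : Prop :=
  φ ∈ Γ ∧ ¬ TarskiAx.Entails (Γ \ {φ}) φ

/-!
Each of the six sentences fails in a structure that satisfies the other nine.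

* Structures on at most three points suffice for (Lo₂), (SC) and (IB). With one point, (Lo₂) fails.
  If only the ends of a segment lie on it, segments cannot be prolonged. If three points are in the
  betweenness relation exactly when two of them coincide, `B a b a` always holds. On three points,
  with congruence distinguishing only degenerate from nondegenerate segments, the premise of (Up₂)
  forces the points in question to coincide, and the five-segments sentence is nearly empty because
  betweenness of `a`, `b`, `c` with `a ≠ b` determines `c` up to the choice of an end.
* (Up₂), (Co) and (Eu) need genuine geometries. All are convex subsets of vector spaces over ordered
  fields with the inherited betweenness (`convexModel`), for which (IB) and (Pa), and over `ℝ` also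
  (Co), hold whatever the congruence relation is.
  - Euclidean `n`-space, `n ≥ 2`, over an ordered field with square roots of nonnegative elements
    satisfies all sentences but (Up₂) and (Co). Real `3`-space violates (Up₂). The plane over the
    real algebraic numbers violates (Co), because a transcendental number cuts a line into two sets
    with no point in between.
  - The Klein model of the hyperbolic plane on the open unit disk violates (Eu). The hyperbolic
    cosine of the distance, `kleinCosh`, is the negative of the Minkowski inner product of points
    on the hyperboloid over the disk, and thus bilinear in them. For `a ≠ b` and `b` between `a` and
    `c` the point of the hyperboloid over `c` is a linear combination of those over `a` and `b`
    whose coefficients depend only on the distances `ab` and `bc`, and the five-segments sentence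
    follows. Prolonging a segment amounts to a quadratic equation, solved by
    the intermediate value theorem.
-/

open scoped Matrix

/-! ### Countermodels -/

/-- A label is independent in `CE₂'` as soon as some structure violates it and satisfies every other
label. -/
theorem TarskiAx.IndependentIn.of_model {φ : TarskiAx} {P : Type} [Nonempty P]
    (M : TarskiStructure P) (hM : ∀ ψ : TarskiAx, ψ ≠ φ → ψ.HoldsIn M) (hφ : ¬ φ.HoldsIn M) :
    φ.IndependentIn CE₂' := by
  refine ⟨by cases φ <;> simp [CE₂'], fun h => hφ (h P M fun ψ hψ => hM ψ ?_)⟩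
  simpa using hψ.2

/-! ### Finite models -/

/-- The structure with a single point; both relations always hold. -/
def pointModel : TarskiStructure Unit where
  B _ _ _ := True
  Cong _ _ _ _ := True

theorem independentIn_Lo₂ : TarskiAx.Lo₂.IndependentIn CE₂' := by
  refine .of_model pointModel (fun ψ hψ => ?_) ?_
  · cases ψ <;> simp_all [TarskiAx.HoldsIn, pointModel, TarskiStructure.TE, TarskiStructure.IE,
      TarskiStructure.SC, TarskiStructure.FS', TarskiStructure.IB, TarskiStructure.Pa,
      TarskiStructure.Up₂, TarskiStructure.Eu, TarskiStructure.Co]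
  · simp [TarskiAx.HoldsIn, pointModel, TarskiStructure.Lo₂]

/-- Three points, the only points of a segment being its ends. Two segments are congruent when both
or neither are degenerate. -/
def endpointModel : TarskiStructure (Fin 3) where
  B a b c := a = b ∨ b = c
  Cong a b c d := a = b ↔ c = d

theorem independentIn_SC : TarskiAx.SC.IndependentIn CE₂' := by
  refine .of_model endpointModel (fun ψ hψ => ?_) ?_
  · cases ψ <;> simp only [TarskiAx.HoldsIn, endpointModel]
    · simp only [TarskiStructure.TE]; grind
    · simp only [TarskiStructure.IE]; grind
    · exact absurd rfl hψ
    · simp only [TarskiStructure.FS']; grind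
    · simp only [TarskiStructure.IB]; grind
    · intro a b c p q h
      simp only at h ⊢
      by_cases hap : a = p
      · exact ⟨p, by grind⟩
      · exact ⟨q, by grind⟩
    · exact ⟨0, 1, 2, by decide⟩
    · simp only [TarskiStructure.Up₂]; grind
    · intro a b c d t h
      exact ⟨b, c, by grind⟩
    · rintro X Y ⟨a, h⟩
      simp only at h ⊢
      by_cases hX : ∃ x ∈ X, x ≠ a
      · obtain ⟨x, hx, hxa⟩ := hX
        exact ⟨x, by grind⟩
      · exact ⟨a, by grind⟩
  · intro h
    obtain ⟨x, h₁, h₂⟩ := h 0 0 1 1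
    simp only [endpointModel] at h₁ h₂
    grind

/-- Three points, three points being in the betweenness relation when they are not distinct. Two
segments are congruent when both or neither are degenerate. -/
def coincidenceModel : TarskiStructure (Fin 3) where
  B a b c := a = b ∨ b = c ∨ a = c
  Cong a b c d := a = b ↔ c = d

theorem independentIn_IB : TarskiAx.IB.IndependentIn CE₂' := by
  refine .of_model coincidenceModel (fun ψ hψ => ?_) ?_
  · cases ψ <;> simp only [TarskiAx.HoldsIn, coincidenceModel]
    · simp only [TarskiStructure.TE]; grind
    · simp only [TarskiStructure.IE]; grind
    · intro a b c q
      simp only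
      by_cases hbc : b = c
      · exact ⟨a, by grind⟩
      by_cases hqa : q = a
      · obtain ⟨x, hx⟩ := exists_ne a
        exact ⟨x, by grind⟩
      · exact ⟨q, by grind⟩
    · simp only [TarskiStructure.FS']; grind
    · exact absurd rfl hψ
    · intro a b c p q h
      simp only at h ⊢
      by_cases h₁ : p = a ∨ p = q
      · exact ⟨p, by grind⟩
      by_cases h₂ : q = b ∨ a = b
      · exact ⟨b, by grind⟩
      by_cases h₃ : p = b
      · exact ⟨a, by grind⟩
      · exact ⟨b, by grind⟩
    · exact ⟨0, 1, 2, by decide⟩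
    · simp only [TarskiStructure.Up₂]; grind
    · intro a b c d t h
      exact ⟨a, a, by grind⟩
    · rintro X Y ⟨a, h⟩
      exact ⟨a, by grind⟩
  · intro h
    exact absurd (h 0 1 (.inr (.inr rfl))) (by decide)

/-! ### Convex sets as models -/

section ConvexModel

variable {F V : Type} [Field F] [LinearOrder F] [AddCommGroup V] [Module F V]

/-- The structure on a subset `S` of a vector space over an ordered field with the betweenness of
the vector space, and with segments congruent when `δ` takes the same value on them. -/
def convexModel (F : Type) {V : Type} [Field F] [LinearOrder F] [AddCommGroup V] [Module F V]
    (S : Set V) (δ : V → V → F) : TarskiStructure S where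
  B a b c := Wbtw F (a : V) b c
  Cong a b c d := δ a b = δ c d

variable {S : Set V} {δ : V → V → F}

theorem wbtw_iff_exists_add_smul {a b c : V} :
    Wbtw F a b c ↔ ∃ t : F, 0 ≤ t ∧ t ≤ 1 ∧ b = a + t • (c - a) := by
  constructor
  · rintro ⟨t, ⟨h₀, h₁⟩, rfl⟩
    exact ⟨t, h₀, h₁, by simp [AffineMap.lineMap_apply, add_comm]⟩
  · rintro ⟨t, h₀, h₁, rfl⟩
    exact ⟨t, ⟨h₀, h₁⟩, by simp [AffineMap.lineMap_apply, add_comm]⟩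

theorem convexModel_TE : (convexModel F S δ).TE :=
  fun _ _ _ _ _ _ h => h.1.symm.trans h.2

variable [IsStrictOrderedRing F]

/-- The far end of a segment is obtained by prolonging its nondegenerate first part. -/
theorem Wbtw.exists_eq_add_smul {a b c : V} (h : Wbtw F a b c) (hab : a ≠ b) :
    ∃ k : F, 0 ≤ k ∧ c = b + k • (b - a) := by
  obtain ⟨t, h₀, h₁, rfl⟩ := wbtw_iff_exists_add_smul.1 h
  have ht : t ≠ 0 := by rintro rfl; simp at hab
  refine ⟨(1 - t) / t, div_nonneg (by linarith) h₀, ?_⟩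
  match_scalars
  · field_simp
    ring
  · field_simp
    ring

theorem wbtw_add_smul_sub (a b : V) {k : F} (hk : 0 ≤ k) : Wbtw F a b (b + k • (b - a)) := by
  have hk' : 1 + k ≠ 0 := by positivity
  refine wbtw_iff_exists_add_smul.2 ⟨1 / (1 + k), by positivity, ?_, ?_⟩
  · rw [div_le_one (by positivity)]; linarith
  · match_scalars
    · field_simp
    · field_simp
      ring

theorem convexModel_IB : (convexModel F S δ).IB :=
  fun _ _ h => Subtype.ext (wbtw_self_iff F |>.1 h).symm

theorem exists_wbtw_wbtw_of_wbtw {a b c p q : V} (hp : Wbtw F a p c) (hq : Wbtw F b q c) :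
    ∃ x, Wbtw F p x b ∧ Wbtw F q x a := by
  obtain ⟨s, hs₀, hs₁, rfl⟩ := wbtw_iff_exists_add_smul.1 hp
  obtain ⟨t, ht₀, ht₁, rfl⟩ := wbtw_iff_exists_add_smul.1 hq
  have hst : 0 ≤ s * (1 - t) := mul_nonneg hs₀ (by linarith)
  have hts : 0 ≤ t * (1 - s) := mul_nonneg ht₀ (by linarith)
  -- The two cevians `pb` and `qa` cut each other in the ratios given by comparing the coefficients
  -- of `a`, `b` and `c`; the common denominator vanishes only if `p = a` and `q = b`.
  by_cases hD : s + t * (1 - s) = 0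
  · have hs : s = 0 := by linarith
    have ht : t = 0 := by simpa [hs] using hD
    subst hs ht
    exact ⟨a, by simp, by simp⟩
  have hD' : s + t - s * t ≠ 0 := by convert hD using 1; ring
  have hpos : 0 < s + t - s * t := lt_of_le_of_ne (by linarith) (Ne.symm hD')
  refine ⟨a + s • (c - a) + (s * (1 - t) / (s + t - s * t)) • (b - (a + s • (c - a))),
    wbtw_iff_exists_add_smul.2 ⟨_, by positivity, ?_, rfl⟩,
    wbtw_iff_exists_add_smul.2 ⟨t * (1 - s) / (s + t - s * t), by positivity, ?_, ?_⟩⟩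
  · rw [div_le_one hpos]; linarith
  · rw [div_le_one hpos]; linarith
  · match_scalars <;> field_simp <;> ring

theorem convexModel_Pa (hS : Convex F S) : (convexModel F S δ).Pa := by
  rintro a b c p q ⟨hp, hq⟩
  obtain ⟨x, h₁, h₂⟩ := exists_wbtw_wbtw_of_wbtw hp hq
  exact ⟨⟨x, hS.mem_of_wbtw h₁ p.2 b.2⟩, h₁, h₂⟩

theorem convexModel_Up₂ (h : ∀ p ∈ S, ∀ q ∈ S, p ≠ q → Collinear F {x ∈ S | δ x p = δ x q}) :
    (convexModel F S δ).Up₂ := by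
  rintro a b c p q ⟨hpq, ha, hb, hc⟩
  refine Collinear.wbtw_or_wbtw_or_wbtw
    ((h p p.2 q q.2 (Subtype.coe_injective.ne hpq)).subset ?_)
  rintro x (rfl | rfl | rfl)
  exacts [⟨a.2, ha⟩, ⟨b.2, hb⟩, ⟨c.2, hc⟩]

end ConvexModel

theorem exists_forall_wbtw_of_forall_wbtw {V : Type} [AddCommGroup V] [Module ℝ V] {X Y : Set V}
    (hY : Y.Nonempty) {a : V} (h : ∀ x ∈ X, ∀ y ∈ Y, Wbtw ℝ a x y) :
    ∃ b, ∀ x ∈ X, ∀ y ∈ Y, Wbtw ℝ x b y := by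
  by_cases hXa : ∀ x ∈ X, x = a
  · exact ⟨a, fun x hx y _ => hXa x hx ▸ wbtw_self_left ℝ a y⟩
  push Not at hXa
  obtain ⟨x₀, hx₀, hne⟩ := hXa
  obtain ⟨y₀, hy₀⟩ := hY
  -- Everything lies on the ray from `a` through `x₀`, which is parametrized by `f` on `[0, ∞)`.
  set f : ℝ →ᵃ[ℝ] V := AffineMap.lineMap a x₀ with hf
  have hinj : Function.Injective f := AffineMap.lineMap_injective ℝ hne.symm
  have hf0 : f 0 = a := by simp [hf]
  have hy : ∀ y ∈ Y, ∃ u : ℝ, 1 ≤ u ∧ f u = y := fun y hy =>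
    (h x₀ hx₀ y hy).right_mem_image_Ici_of_left_ne hne.symm
  have hle : ∀ s u : ℝ, 0 ≤ u → Wbtw ℝ a (f s) (f u) → s ≤ u := fun s u hu hw => by
    rw [← hf0, hinj.wbtw_map_iff, wbtw_iff_of_le hu] at hw
    exact hw.2
  have hx : ∀ x ∈ X, ∃ s : ℝ, f s = x := fun x hx => by
    obtain ⟨u, hu, rfl⟩ := hy y₀ hy₀
    obtain ⟨t, -, rfl⟩ := h x hx _ hy₀
    exact ⟨AffineMap.lineMap 0 u t, by rw [AffineMap.apply_lineMap, hf0]⟩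
  have hbound : ∀ y ∈ Y, ∀ u : ℝ, f u = y → u ∈ upperBounds {s | f s ∈ X} := by
    rintro _ hyY u rfl s hs
    obtain ⟨v, hv, hvu⟩ := hy _ hyY
    obtain rfl := hinj hvu
    exact hle s v (by linarith) (h _ hs _ hyY)
  obtain ⟨u₀, -, hu₀⟩ := hy y₀ hy₀
  refine ⟨f (sSup {s | f s ∈ X}), fun x hxX y hyY => ?_⟩
  obtain ⟨s, rfl⟩ := hx x hxX
  obtain ⟨u, -, rfl⟩ := hy y hyY
  refine hinj.wbtw_map_iff.2 (.of_le_of_le (le_csSup ⟨u₀, hbound y₀ hy₀ u₀ hu₀⟩ hxX) ?_)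
  exact csSup_le ⟨s, hxX⟩ (hbound _ hyY u rfl)

theorem convexModel_Co {V : Type} [AddCommGroup V] [Module ℝ V] {S : Set V} {δ : V → V → ℝ}
    (hS : Convex ℝ S) : (convexModel ℝ S δ).Co := by
  rintro X Y ⟨a, h⟩
  rcases X.eq_empty_or_nonempty with rfl | ⟨x₀, hx₀⟩
  · exact ⟨a, by simp⟩
  rcases Y.eq_empty_or_nonempty with rfl | ⟨y₀, hy₀⟩
  · exact ⟨a, by simp⟩
  obtain ⟨b, hb⟩ := exists_forall_wbtw_of_forall_wbtw (X := (↑) '' X) (Y := (↑) '' Y) (a := (a : V))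
    ⟨_, y₀, hy₀, rfl⟩ (by rintro _ ⟨x, hx, rfl⟩ _ ⟨y, hy, rfl⟩; exact h x y ⟨hx, hy⟩)
  exact ⟨⟨b, hS.mem_of_wbtw (hb _ ⟨x₀, hx₀, rfl⟩ _ ⟨y₀, hy₀, rfl⟩) x₀.2 y₀.2⟩,
    fun x y hxy => hb _ ⟨x, hxy.1, rfl⟩ _ ⟨y, hxy.2, rfl⟩⟩

section Coordinates

variable {F : Type} [Field F] [LinearOrder F] [IsStrictOrderedRing F] {n : ℕ}

theorem convexModel_Lo₂ {S : Set (Fin n → F)} {δ : (Fin n → F) → (Fin n → F) → F} {i j : Fin n}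
    (hij : i ≠ j) {ε : F} (hε : ε ≠ 0) (h₀ : 0 ∈ S) (hi : Pi.single i ε ∈ S)
    (hj : Pi.single j ε ∈ S) : (convexModel F S δ).Lo₂ := by
  refine ⟨⟨_, h₀⟩, ⟨_, hi⟩, ⟨_, hj⟩, ?_, ?_, ?_⟩ <;>
  · intro h
    obtain ⟨t, -, -, h⟩ := wbtw_iff_exists_add_smul.1 h
    have h₁ := congrFun h i
    have h₂ := congrFun h j
    simp [hij, hij.symm, hε] at h₁ h₂
    try simp [h₁, hε.symm] at h₂

theorem collinear_setOf_dotProduct_eq {m : Fin 2 → F} (hm : m ≠ 0) (k : F) :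
    Collinear F {x | x ⬝ᵥ m = k} := by
  rcases Set.eq_empty_or_nonempty {x | x ⬝ᵥ m = k} with h | ⟨p, hp⟩
  · rw [h]; exact collinear_empty F _
  refine (collinear_iff_of_mem hp).2 ⟨![-m 1, m 0], fun x hx => ?_⟩
  have hpos : m 0 ^ 2 + m 1 ^ 2 ≠ 0 := fun h => hm <| by
    ext i; fin_cases i <;> simp <;> nlinarith [sq_nonneg (m 0), sq_nonneg (m 1)]
  simp only [Set.mem_ofPred_eq, dotProduct, Fin.sum_univ_two] at hp hx
  refine ⟨((x 1 - p 1) * m 0 - (x 0 - p 0) * m 1) / (m 0 ^ 2 + m 1 ^ 2), ?_⟩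
  ext i; fin_cases i <;> simp <;> field_simp
  · linear_combination m 0 * (hx - hp)
  · linear_combination m 1 * (hx - hp)

end Coordinates

/-! ### Euclidean spaces -/

section Euclidean

/-- Euclidean `n`-space over an ordered field `F`; segments are congruent when the squares of their
lengths agree. -/
def euclideanModel (F : Type) [Field F] [LinearOrder F] (n : ℕ) :
    TarskiStructure (Set.univ : Set (Fin n → F)) :=
  convexModel F Set.univ fun x y => (y - x) ⬝ᵥ (y - x)

variable {F : Type} [Field F] [LinearOrder F] {n : ℕ}

theorem euclideanModel_TE : (euclideanModel F n).TE := convexModel_TE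

variable [IsStrictOrderedRing F]

theorem dotProduct_self_nonneg_of_ordered (x : Fin n → F) : 0 ≤ x ⬝ᵥ x :=
  Finset.sum_nonneg fun i _ => mul_self_nonneg (x i)

theorem euclideanModel_IE : (euclideanModel F n).IE := by
  intro a b c h
  have h : (b.1 - a.1) ⬝ᵥ (b.1 - a.1) = 0 := Eq.trans h (by simp)
  exact Subtype.ext (sub_eq_zero.1 (dotProduct_self_eq_zero.1 h)).symm

theorem euclideanModel_SC (hF : ∀ x : F, 0 ≤ x → IsSquare x) :
    (euclideanModel F (n + 1)).SC := by
  rintro ⟨a, _⟩ ⟨b, _⟩ ⟨c, _⟩ ⟨q, _⟩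
  -- A direction in which the segment may be laid off: any one at all if `q = a`.
  obtain ⟨q', hq', hw⟩ : ∃ q' : Fin (n + 1) → F, q' ≠ a ∧
      ∀ k : F, 0 ≤ k → Wbtw F q a (a + k • (a - q')) := by
    by_cases hqa : q = a
    · obtain ⟨q', hq'⟩ := exists_ne a
      exact ⟨q', hq', fun k _ => hqa ▸ wbtw_self_left F q _⟩
    · exact ⟨q, hqa, fun k hk => wbtw_add_smul_sub q a hk⟩
  have hpos : (a - q') ⬝ᵥ (a - q') ≠ 0 := fun h =>
    hq' (sub_eq_zero.1 (dotProduct_self_eq_zero.1 h)).symm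
  obtain ⟨r, hr⟩ := hF ((c - b) ⬝ᵥ (c - b) / (a - q') ⬝ᵥ (a - q'))
    (div_nonneg (dotProduct_self_nonneg_of_ordered _) (dotProduct_self_nonneg_of_ordered _))
  rw [div_eq_iff hpos] at hr
  refine ⟨⟨a + |r| • (a - q'), trivial⟩, hw _ (abs_nonneg r), ?_⟩
  simp only [euclideanModel, convexModel, add_sub_cancel_left, smul_dotProduct, dotProduct_smul,
    smul_eq_mul, hr]
  rw [← mul_assoc, abs_mul_abs_self]

theorem euclideanModel_FS' : (euclideanModel F n).FS' := by
  rintro ⟨a, _⟩ ⟨b, _⟩ ⟨c, _⟩ ⟨d, _⟩ ⟨a', _⟩ ⟨b', _⟩ ⟨c', _⟩ ⟨d', _⟩ ⟨hab, hw, hw', h₁, h₂, h₃, h₄⟩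
  simp only [euclideanModel, convexModel] at hw hw' h₁ h₂ h₃ h₄ ⊢
  have hab : a ≠ b := fun h => hab (Subtype.ext h)
  have hne : (b - a) ⬝ᵥ (b - a) ≠ 0 := fun h =>
    hab (sub_eq_zero.1 (dotProduct_self_eq_zero.1 h)).symm
  have hab' : a' ≠ b' := by
    rintro rfl
    exact hne (h₁.trans (by simp))
  obtain ⟨k, hk, rfl⟩ := hw.exists_eq_add_smul hab
  obtain ⟨k', hk', rfl⟩ := hw'.exists_eq_add_smul hab'
  -- The ratios of prolongation agree.
  obtain rfl : k = k' := by
    simp only [add_sub_cancel_left, smul_dotProduct, dotProduct_smul, smul_eq_mul, ← h₁,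
      ← mul_assoc] at h₂
    exact (mul_self_inj hk hk').1 (mul_right_cancel₀ hne h₂)
  -- Hence the length of `cd` is the same expression in those of `ab`, `ad` and `bd` on both sides.
  have key : ∀ x y z : Fin n → F, (y + k • (y - x) - z) ⬝ᵥ (y + k • (y - x) - z) =
      (1 + k) * ((z - y) ⬝ᵥ (z - y)) - k * ((z - x) ⬝ᵥ (z - x)) +
        k * (1 + k) * ((y - x) ⬝ᵥ (y - x)) := fun x y z => by
    simp only [add_dotProduct, sub_dotProduct, smul_dotProduct, dotProduct_add, dotProduct_sub,
      dotProduct_smul, smul_eq_mul]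
    rw [dotProduct_comm y x, dotProduct_comm z x, dotProduct_comm z y]
    ring
  have swap : ∀ x y : Fin n → F, (y - x) ⬝ᵥ (y - x) = (x - y) ⬝ᵥ (x - y) := fun x y => by
    rw [← neg_sub x y, neg_dotProduct_neg]
  rw [key, h₁, h₃, h₄, ← key, swap]

theorem euclideanModel_Pa : (euclideanModel F n).Pa := convexModel_Pa convex_univ

theorem euclideanModel_Lo₂ : (euclideanModel F (n + 2)).Lo₂ :=
  convexModel_Lo₂ (i := 0) (j := 1) (by simp) one_ne_zero trivial trivial trivial

theorem euclideanModel_Up₂ : (euclideanModel F 2).Up₂ := by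
  refine convexModel_Up₂ fun p _ q _ hpq => ?_
  refine (collinear_setOf_dotProduct_eq (sub_ne_zero.2 hpq)
    ((p ⬝ᵥ p - q ⬝ᵥ q) / 2)).subset ?_
  rintro x ⟨-, hx⟩
  simp only [dotProduct, Fin.sum_univ_two, Pi.sub_apply, Set.mem_ofPred_eq] at hx ⊢
  linear_combination - hx / 2

theorem euclideanModel_Eu : (euclideanModel F n).Eu := by
  rintro ⟨a, _⟩ ⟨b, _⟩ ⟨c, _⟩ ⟨d, _⟩ ⟨t, _⟩ ⟨h₁, h₂, hne⟩
  have hne : a ≠ d := fun h => hne (Subtype.ext h)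
  -- The homothety with centre `a` that takes `d` to `t` takes `b` and `c` to suitable points.
  obtain ⟨k, hk, rfl⟩ := Wbtw.exists_eq_add_smul h₁ hne
  refine ⟨⟨b + k • (b - a), trivial⟩, ⟨c + k • (c - a), trivial⟩, wbtw_add_smul_sub a b hk,
    wbtw_add_smul_sub a c hk, ?_⟩
  have key : ∀ x : Fin n → F, AffineMap.homothety a (1 + k) x = x + k • (x - a) := fun x => by
    simp only [AffineMap.homothety_apply, vsub_eq_sub, vadd_eq_add]
    module
  simpa only [key] using! Wbtw.map h₂ (AffineMap.homothety a (1 + k))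

end Euclidean

theorem independentIn_Up₂ : TarskiAx.Up₂.IndependentIn CE₂' := by
  refine .of_model (euclideanModel ℝ 3) (fun ψ hψ => ?_) fun h => ?_
  · cases ψ
    · exact euclideanModel_TE
    · exact euclideanModel_IE
    · exact euclideanModel_SC fun x hx => ⟨√x, (Real.mul_self_sqrt hx).symm⟩
    · exact euclideanModel_FS'
    · exact convexModel_IB
    · exact euclideanModel_Pa
    · exact euclideanModel_Lo₂
    · exact absurd rfl hψ
    · exact euclideanModel_Eu
    · exact convexModel_Co convex_univ
  · -- Both points `±e₂` are equidistant from the noncollinear points `0`, `e₀` and `e₁`.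
    obtain ⟨a, b, c, hn⟩ : ∃ a b c : (Set.univ : Set (Fin 3 → ℝ)),
        (a : Fin 3 → ℝ) = ![0, 0, 0] ∧ (b : Fin 3 → ℝ) = ![1, 0, 0] ∧ (c : Fin 3 → ℝ) = ![0, 1, 0] :=
      ⟨⟨_, trivial⟩, ⟨_, trivial⟩, ⟨_, trivial⟩, rfl, rfl, rfl⟩
    have := h a b c ⟨![0, 0, 1], trivial⟩ ⟨![0, 0, -1], trivial⟩ ⟨?_, ?_, ?_, ?_⟩
    · simp only [euclideanModel, convexModel, hn, wbtw_iff_exists_add_smul] at this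
      rcases this with ⟨t, -, -, h⟩ | ⟨t, -, -, h⟩ | ⟨t, -, -, h⟩ <;>
      · have h₀ := congrFun h 0
        have h₁ := congrFun h 1
        simp at h₀ h₁
        try linarith
    · intro h
      have : (1 : ℝ) = -1 := congrFun (congrArg Subtype.val h) 2
      norm_num at this
    all_goals simp [euclideanModel, convexModel, hn, dotProduct, Fin.sum_univ_three]

/-! ### The plane over the real algebraic numbers -/

theorem isSquare_of_nonneg_of_mem_algebraicClosure (x : algebraicClosure ℚ ℝ) (hx : 0 ≤ x) :
    IsSquare x := by
  refine ⟨⟨√(x : ℝ), mem_algebraicClosure_iff.2 (.of_pow two_pos ?_)⟩, Subtype.ext ?_⟩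
  · rw [Real.sq_sqrt hx]
    exact mem_algebraicClosure_iff.1 x.2
  · exact (Real.mul_self_sqrt hx).symm

theorem exists_pos_notMem_algebraicClosure : ∃ τ : ℝ, 0 < τ ∧ τ ∉ algebraicClosure ℚ ℝ := by
  obtain ⟨τ, hτ⟩ : ∃ τ : ℝ, τ ∉ algebraicClosure ℚ ℝ := by
    refine ⟨liouvilleNumber (2 : ℕ), fun h => transcendental_liouvilleNumber le_rfl ?_⟩
    exact (IsFractionRing.isAlgebraic_iff ℤ ℚ ℝ).2 (mem_algebraicClosure_iff.1 h)
  refine ⟨|τ|, abs_pos.2 fun h => hτ (h ▸ zero_mem _), fun h => hτ ?_⟩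
  rcases abs_choice τ with h' | h' <;> rw [h'] at h
  exacts [h, by simpa using h]

/-- On a coordinate axis of the plane over the real algebraic numbers, a transcendental number
separates two sets between which there is no point. -/
theorem not_euclideanModel_algebraicClosure_Co : ¬ (euclideanModel (algebraicClosure ℚ ℝ) 2).Co := by
  intro h
  obtain ⟨τ, hτ₀, hτ⟩ := exists_pos_notMem_algebraicClosure
  let f : algebraicClosure ℚ ℝ →ᵃ[algebraicClosure ℚ ℝ] Fin 2 → algebraicClosure ℚ ℝ :=
    AffineMap.lineMap 0 (Pi.single 0 1)
  have hf : ∀ s, f s 0 = s := fun s => by simp [f, AffineMap.lineMap_apply]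
  have hq : ∀ q : ℚ, ((q : algebraicClosure ℚ ℝ) : ℝ) = q := fun q => by simp
  obtain ⟨⟨b, _⟩, hb⟩ := h {x | ∃ s : algebraicClosure ℚ ℝ, 0 ≤ s ∧ (s : ℝ) < τ ∧ x.1 = f s}
    {x | ∃ s : algebraicClosure ℚ ℝ, τ < (s : ℝ) ∧ x.1 = f s} ⟨⟨f 0, trivial⟩, by
      rintro ⟨_, _⟩ ⟨_, _⟩ ⟨⟨s, hs, hsτ, rfl⟩, ⟨u, hu, rfl⟩⟩
      exact Wbtw.map (.of_le_of_le hs (show s ≤ u from (hsτ.trans hu).le)) f⟩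
  have hb' : ∀ s u : algebraicClosure ℚ ℝ, 0 ≤ s → (s : ℝ) < τ → τ < u → s ≤ b 0 ∧ b 0 ≤ u := by
    intro s u hs hsτ hu
    have hw := Wbtw.map (hb ⟨f s, trivial⟩ ⟨f u, trivial⟩ ⟨⟨s, hs, hsτ, rfl⟩, ⟨u, hu, rfl⟩⟩)
      (LinearMap.proj (R := algebraicClosure ℚ ℝ)
        (φ := fun _ : Fin 2 => algebraicClosure ℚ ℝ) 0).toAffineMap
    simp only [LinearMap.coe_toAffineMap, LinearMap.proj_apply, hf] at hw
    exact (wbtw_iff_of_le (show s ≤ u from (hsτ.trans hu).le)).1 hw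
  have hne : ((b 0 : algebraicClosure ℚ ℝ) : ℝ) ≠ τ := fun h => hτ (h ▸ (b 0).2)
  obtain ⟨u, hu⟩ := exists_rat_gt τ
  rcases hne.lt_or_gt with hlt | hgt
  · obtain ⟨q, hq₁, hq₂⟩ := exists_rat_btwn (max_lt hlt hτ₀)
    have := (hb' q u (show (0 : ℝ) ≤ _ by rw [hq]; exact (le_max_right _ _).trans hq₁.le)
      (by rwa [hq]) (by rwa [hq])).1
    have : ((q : algebraicClosure ℚ ℝ) : ℝ) ≤ b 0 := this
    rw [hq] at this
    exact absurd ((le_max_left _ _).trans_lt hq₁) this.not_gt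
  · obtain ⟨q, hq₁, hq₂⟩ := exists_rat_btwn hgt
    have : ((b 0 : algebraicClosure ℚ ℝ) : ℝ) ≤ (q : algebraicClosure ℚ ℝ) :=
      (hb' 0 q le_rfl hτ₀ (by rwa [hq])).2
    rw [hq] at this
    exact absurd hq₂ this.not_gt

theorem independentIn_Co : TarskiAx.Co.IndependentIn CE₂' := by
  refine .of_model (euclideanModel (algebraicClosure ℚ ℝ) 2) (fun ψ hψ => ?_)
    not_euclideanModel_algebraicClosure_Co
  cases ψ
  · exact euclideanModel_TE
  · exact euclideanModel_IE
  · exact euclideanModel_SC isSquare_of_nonneg_of_mem_algebraicClosure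
  · exact euclideanModel_FS'
  · exact convexModel_IB
  · exact euclideanModel_Pa
  · exact euclideanModel_Lo₂
  · exact euclideanModel_Up₂
  · exact euclideanModel_Eu
  · exact absurd rfl hψ

/-! ### The hyperbolic plane -/

/-- The open unit disk. -/
def openDisk : Set (Fin 2 → ℝ) := {x | x ⬝ᵥ x < 1}

/-- The factor by which the vector `(1, x)` of Minkowski space, `x` a point of the open unit disk,
has to be scaled to lie on the unit hyperboloid. -/
noncomputable def kleinWeight (x : Fin 2 → ℝ) : ℝ := (√(1 - x ⬝ᵥ x))⁻¹

/-- The hyperbolic cosine of the distance of two points of the open unit disk in the Klein metric: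
up to sign, the Minkowski inner product of the corresponding points of the unit hyperboloid. -/
noncomputable def kleinCosh (x y : Fin 2 → ℝ) : ℝ :=
  kleinWeight x * kleinWeight y * (1 - x ⬝ᵥ y)

/-- The Klein model of the hyperbolic plane. -/
noncomputable def kleinModel : TarskiStructure openDisk := convexModel ℝ openDisk kleinCosh

variable {x y a b c : Fin 2 → ℝ}

theorem one_sub_dotProduct_pos (hx : x ∈ openDisk) (hy : y ∈ openDisk) : 0 < 1 - x ⬝ᵥ y := by
  simp only [openDisk, Set.mem_ofPred_eq, dotProduct, Fin.sum_univ_two] at *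
  nlinarith [sq_nonneg (x 0 - y 0), sq_nonneg (x 1 - y 1)]

theorem convex_openDisk : Convex ℝ openDisk := by
  intro x hx y hy s t hs ht hst
  obtain rfl : s = 1 - t := by linarith
  have h : 1 - ((1 - t) • x + t • y) ⬝ᵥ ((1 - t) • x + t • y) = (1 - t) * ((1 - t) * (1 - x ⬝ᵥ x))
      + 2 * ((1 - t) * (t * (1 - x ⬝ᵥ y))) + t * (t * (1 - y ⬝ᵥ y)) := by
    simp only [dotProduct, Fin.sum_univ_two, Pi.add_apply, Pi.smul_apply, smul_eq_mul]
    ring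
  have hxx := one_sub_dotProduct_pos hx hx
  have hxy := one_sub_dotProduct_pos hx hy
  have hyy := one_sub_dotProduct_pos hy hy
  have : 0 < 1 - ((1 - t) • x + t • y) ⬝ᵥ ((1 - t) • x + t • y) := by
    rw [h]
    rcases ht.eq_or_lt with rfl | ht
    · simpa using hxx
    · positivity
  exact sub_pos.1 this

theorem kleinWeight_pos (hx : x ∈ openDisk) : 0 < kleinWeight x :=
  inv_pos.2 (Real.sqrt_pos.2 (one_sub_dotProduct_pos hx hx))

theorem kleinWeight_sq_mul (hx : x ∈ openDisk) : kleinWeight x ^ 2 * (1 - x ⬝ᵥ x) = 1 := by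
  have h := one_sub_dotProduct_pos hx hx
  rw [kleinWeight, inv_pow, Real.sq_sqrt h.le, inv_mul_cancel₀ h.ne']

theorem kleinCosh_comm (x y : Fin 2 → ℝ) : kleinCosh x y = kleinCosh y x := by
  rw [kleinCosh, kleinCosh, dotProduct_comm, mul_comm (kleinWeight x)]

theorem kleinCosh_self (hx : x ∈ openDisk) : kleinCosh x x = 1 := by
  rw [← kleinWeight_sq_mul hx, kleinCosh, sq]

theorem kleinCosh_pos (hx : x ∈ openDisk) (hy : y ∈ openDisk) : 0 < kleinCosh x y :=
  mul_pos (mul_pos (kleinWeight_pos hx) (kleinWeight_pos hy)) (one_sub_dotProduct_pos hx hy)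

theorem kleinCosh_sq_mul (hx : x ∈ openDisk) (hy : y ∈ openDisk) :
    kleinCosh x y ^ 2 * ((1 - x ⬝ᵥ x) * (1 - y ⬝ᵥ y)) = (1 - x ⬝ᵥ y) ^ 2 := by
  rw [kleinCosh]
  linear_combination (1 - x ⬝ᵥ y) ^ 2 * kleinWeight y ^ 2 * (1 - y ⬝ᵥ y) * kleinWeight_sq_mul hx +
    (1 - x ⬝ᵥ y) ^ 2 * kleinWeight_sq_mul hy

theorem one_lt_kleinCosh (hx : x ∈ openDisk) (hy : y ∈ openDisk) (hne : x ≠ y) :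
    1 < kleinCosh x y := by
  have hxx := one_sub_dotProduct_pos hx hx
  have hyy := one_sub_dotProduct_pos hy hy
  have hsq := kleinCosh_sq_mul hx hy
  have hd : 0 < (y - x) ⬝ᵥ (y - x) :=
    (dotProduct_self_nonneg_of_ordered _).lt_of_ne'
      fun h => hne (sub_eq_zero.1 (dotProduct_self_eq_zero.1 h)).symm
  -- The Cauchy–Schwarz defect of `(1, x)` and `(1, y)` is `|d|² - (x × d)²` with `d = y - x`.
  have hlt : (1 - x ⬝ᵥ x) * (1 - y ⬝ᵥ y) < (1 - x ⬝ᵥ y) ^ 2 := by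
    have := mul_pos hxx hd
    simp only [dotProduct, Fin.sum_univ_two, Pi.sub_apply] at this ⊢
    nlinarith [sq_nonneg (x 0 * (y 0 - x 0) + x 1 * (y 1 - x 1))]
  rw [← hsq] at hlt
  have h1 : 1 < kleinCosh x y ^ 2 := by
    by_contra! h
    exact absurd hlt (mul_le_of_le_one_left (mul_pos hxx hyy).le h).not_gt
  exact lt_of_pow_lt_pow_left₀ 2 (kleinCosh_pos hx hy).le (by simpa using h1)

theorem one_le_kleinCosh (hx : x ∈ openDisk) (hy : y ∈ openDisk) : 1 ≤ kleinCosh x y := by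
  rcases eq_or_ne x y with rfl | h
  exacts [(kleinCosh_self hx).ge, (one_lt_kleinCosh hx hy h).le]

theorem kleinModel_IE : kleinModel.IE := by
  intro a b c h
  by_contra hne
  exact (one_lt_kleinCosh a.2 b.2 (Subtype.coe_injective.ne hne)).ne'
    (Eq.trans h (kleinCosh_self c.2))

/-- Every hyperbolic distance can be laid off from `a` in the direction `d`. -/
theorem exists_kleinCosh_eq (ha : a ∈ openDisk) {d : Fin 2 → ℝ} (hd : d ≠ 0) {K : ℝ} (hK : 1 ≤ K) :
    ∃ t : ℝ, 0 ≤ t ∧ a + t • d ∈ openDisk ∧ kleinCosh a (a + t • d) = K := by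
  have hα := one_sub_dotProduct_pos ha ha
  have hδ : 0 < d ⬝ᵥ d :=
    (dotProduct_self_nonneg_of_ordered d).lt_of_ne' fun h => hd (dotProduct_self_eq_zero.1 h)
  have hα₁ : 1 - a ⬝ᵥ a ≤ 1 := by linarith [dotProduct_self_nonneg_of_ordered a]
  have h₁ : ∀ t : ℝ, 1 - a ⬝ᵥ (a + t • d) = 1 - a ⬝ᵥ a - t * a ⬝ᵥ d := fun t => by
    simp only [dotProduct_add, dotProduct_smul, smul_eq_mul]; ring
  have h₂ : ∀ t : ℝ, 1 - (a + t • d) ⬝ᵥ (a + t • d) =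
      1 - a ⬝ᵥ a - 2 * t * a ⬝ᵥ d - t ^ 2 * d ⬝ᵥ d := fun t => by
    simp only [dotProduct_add, add_dotProduct, smul_dotProduct, dotProduct_smul, smul_eq_mul,
      dotProduct_comm d a]
    ring
  obtain ⟨α, hα'⟩ : ∃ α, 1 - a ⬝ᵥ a = α := ⟨_, rfl⟩
  obtain ⟨β, hβ'⟩ : ∃ β, a ⬝ᵥ d = β := ⟨_, rfl⟩
  obtain ⟨δ, hδ'⟩ : ∃ δ, d ⬝ᵥ d = δ := ⟨_, rfl⟩
  simp only [hα', hβ', hδ'] at hα hα₁ hδ h₁ h₂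
  -- The square of the equation to be solved, cleared of denominators.
  let f : ℝ → ℝ := fun t => (α - t * β) ^ 2 - K ^ 2 * (α * (α - 2 * t * β - t ^ 2 * δ))
  -- At the parameter `T` the ray has left the disk.
  set T : ℝ := 1 + (2 * |β| + 1) / δ with hT
  have hT₁ : 1 ≤ T := by
    have : 0 ≤ (2 * |β| + 1) / δ := by positivity
    linarith
  have hTδ : 2 * |β| + 1 ≤ T * δ := by
    rw [hT, add_mul, div_mul_cancel₀ _ hδ.ne']
    linarith
  have hfT : 0 ≤ f T := by
    have h : α - 2 * T * β - T ^ 2 * δ ≤ 0 := by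
      nlinarith [neg_abs_le β]
    have := mul_nonneg (sq_nonneg K) (mul_nonneg hα.le (neg_nonneg.2 h))
    simp only [f]
    nlinarith [sq_nonneg (α - T * β)]
  have hf₀ : f 0 ≤ 0 := by
    have : 0 ≤ α ^ 2 * (K ^ 2 - 1) := mul_nonneg (sq_nonneg α) (by nlinarith)
    simp only [f]
    linarith
  obtain ⟨t, ⟨ht₀, -⟩, ht⟩ := intermediate_value_Icc (zero_le_one.trans hT₁)
    (f := f) (by fun_prop) ⟨hf₀, hfT⟩
  -- A solution of the equation lies in the disk by itself.
  have hg : 0 < α - 2 * t * β - t ^ 2 * δ := by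
    by_contra! hg
    have hle : K ^ 2 * (α * (α - 2 * t * β - t ^ 2 * δ)) ≤ 0 :=
      mul_nonpos_of_nonneg_of_nonpos (sq_nonneg K) (mul_nonpos_of_nonneg_of_nonpos hα.le hg)
    have hsq : (α - t * β) ^ 2 = 0 := le_antisymm (by simp only [f] at ht; linarith) (sq_nonneg _)
    have hαβ : α - t * β = 0 := by simpa using hsq
    have hK0 : K ^ 2 * (α * (α - 2 * t * β - t ^ 2 * δ)) = 0 := by
      simp only [f] at ht; linarith
    have : α - 2 * t * β - t ^ 2 * δ = 0 := by
      simpa [hα.ne', (zero_lt_one.trans_le hK).ne'] using hK0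
    nlinarith [mul_nonneg (sq_nonneg t) hδ.le]
  have hmem : a + t • d ∈ openDisk := sub_pos.1 ((h₂ t).symm ▸ hg)
  refine ⟨t, ht₀, hmem, ?_⟩
  have hsq := kleinCosh_sq_mul ha hmem
  rw [h₁, h₂, hα'] at hsq
  have : kleinCosh a (a + t • d) ^ 2 = K ^ 2 := by
    refine mul_right_cancel₀ (mul_pos hα hg).ne' (hsq.trans ?_)
    simp only [f] at ht
    linarith
  exact (pow_left_inj₀ (kleinCosh_pos ha hmem).le (zero_le_one.trans hK) two_ne_zero).1 this

theorem kleinModel_SC : kleinModel.SC := by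
  rintro ⟨a, ha⟩ ⟨b, hb⟩ ⟨c, hc⟩ ⟨q, hq⟩
  have hK := one_le_kleinCosh hb hc
  by_cases hqa : q = a
  · subst hqa
    obtain ⟨d, hd⟩ := exists_ne (0 : Fin 2 → ℝ)
    obtain ⟨t, -, hmem, ht⟩ := exists_kleinCosh_eq ha hd hK
    exact ⟨⟨_, hmem⟩, wbtw_self_left ℝ q _, ht⟩
  · obtain ⟨t, ht₀, hmem, ht⟩ := exists_kleinCosh_eq ha (sub_ne_zero.2 (Ne.symm hqa)) hK
    exact ⟨⟨_, hmem⟩, wbtw_add_smul_sub q a ht₀, ht⟩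

/-- The point of the hyperboloid over `c` is a linear combination of those over `a` and `b`, with a
nonpositive coefficient at `a`. -/
theorem exists_kleinCosh_eq_sub (ha : a ∈ openDisk) (hb : b ∈ openDisk) (hc : c ∈ openDisk)
    (hab : a ≠ b) (h : Wbtw ℝ a b c) :
    ∃ l m : ℝ, 0 ≤ l ∧ ∀ d, kleinCosh d c = m * kleinCosh d b - l * kleinCosh d a := by
  obtain ⟨k, hk, rfl⟩ := h.exists_eq_add_smul hab
  have hwa := kleinWeight_pos ha
  have hwb := kleinWeight_pos hb
  have hwc := kleinWeight_pos hc
  set w := kleinWeight (b + k • (b - a)) with hw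
  refine ⟨k * w / kleinWeight a, (1 + k) * w / kleinWeight b, by positivity, fun d => ?_⟩
  simp only [kleinCosh, ← hw, dotProduct_add, dotProduct_smul, dotProduct_sub, smul_eq_mul]
  field_simp
  ring

theorem kleinModel_FS' : kleinModel.FS' := by
  rintro ⟨a, ha⟩ ⟨b, hb⟩ ⟨c, hc⟩ ⟨d, hd⟩ ⟨a', ha'⟩ ⟨b', hb'⟩ ⟨c', hc'⟩ ⟨d', hd'⟩
    ⟨hab, hw, hw', h₁, h₂, h₃, h₄⟩
  simp only [kleinModel, convexModel] at hw hw' h₁ h₂ h₃ h₄ ⊢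
  have hlt : 1 < kleinCosh a b := one_lt_kleinCosh ha hb fun h => hab (Subtype.ext h)
  have hab' : a' ≠ b' := by
    rintro rfl
    rw [h₁, kleinCosh_self ha'] at hlt
    exact hlt.false
  obtain ⟨l, m, hl, H⟩ := exists_kleinCosh_eq_sub ha hb hc (fun h => hab (Subtype.ext h)) hw
  obtain ⟨l', m', hl', H'⟩ := exists_kleinCosh_eq_sub ha' hb' hc' hab' hw'
  -- Both pairs of coefficients are determined by the distances `ab` and `bc`.
  have hm : ∀ {a b c : Fin 2 → ℝ} {l m : ℝ}, b ∈ openDisk →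
      (∀ d, kleinCosh d c = m * kleinCosh d b - l * kleinCosh d a) →
      m = kleinCosh b c + l * kleinCosh a b := fun {a b c l m} hb H => by
    rw [H b, kleinCosh_self hb, kleinCosh_comm a b]; ring
  have hl_sq : ∀ {a b c : Fin 2 → ℝ} {l m : ℝ}, a ∈ openDisk → b ∈ openDisk → c ∈ openDisk →
      (∀ d, kleinCosh d c = m * kleinCosh d b - l * kleinCosh d a) →
      l ^ 2 * (kleinCosh a b ^ 2 - 1) = kleinCosh b c ^ 2 - 1 := fun {a b c l m} ha hb hc H => by
    have h₁ := H c
    have h₂ := H a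
    rw [kleinCosh_self hc, kleinCosh_comm c b, kleinCosh_comm c a, h₂, kleinCosh_self ha,
      hm hb H] at h₁
    linear_combination h₁
  obtain rfl : l = l' := by
    have h := hl_sq ha hb hc H
    rw [h₁, h₂, ← hl_sq ha' hb' hc' H', ← h₁] at h
    exact (pow_left_inj₀ hl hl' two_ne_zero).1 (mul_right_cancel₀ (by nlinarith) h)
  obtain rfl : m = m' := by
    rw [hm hb H, hm hb' H', h₁, h₂]
  rw [kleinCosh_comm c', H, H', kleinCosh_comm d, kleinCosh_comm d, kleinCosh_comm d',
    kleinCosh_comm d', h₃, h₄]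

theorem kleinModel_Lo₂ : kleinModel.Lo₂ := by
  refine convexModel_Lo₂ (i := 0) (j := 1) (ε := 1 / 2) (by simp) (by simp) ?_ ?_ ?_ <;>
    norm_num [openDisk, dotProduct]

/-- The perpendicular bisector of two points is a chord of the disk. -/
theorem kleinModel_Up₂ : kleinModel.Up₂ := by
  refine convexModel_Up₂ fun p hp q hq hpq => ?_
  have hwp := kleinWeight_pos hp
  have hwq := kleinWeight_pos hq
  have heq : ∀ x ∈ openDisk, kleinCosh x p = kleinCosh x q →
      kleinWeight p * (1 - x ⬝ᵥ p) = kleinWeight q * (1 - x ⬝ᵥ q) := fun x hx h => by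
    simp only [kleinCosh, mul_assoc] at h
    exact mul_left_cancel₀ (kleinWeight_pos hx).ne' h
  have hm : kleinWeight p • p - kleinWeight q • q ≠ 0 := by
    intro h
    have h := sub_eq_zero.1 h
    -- The weight of a point is determined by the weighted point, as `w² - |w p|² = 1`.
    have hsq : kleinWeight p ^ 2 = kleinWeight q ^ 2 := by
      have h₁ := kleinWeight_sq_mul hp
      have h₂ := kleinWeight_sq_mul hq
      have h₃ := congrArg (fun v => v ⬝ᵥ v) h
      simp only [smul_dotProduct, dotProduct_smul, smul_eq_mul] at h₃
      linear_combination h₁ - h₂ + h₃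
    rw [(pow_left_inj₀ hwp.le hwq.le two_ne_zero).1 hsq] at h
    exact hpq (smul_right_injective _ hwq.ne' h)
  refine (collinear_setOf_dotProduct_eq hm (kleinWeight p - kleinWeight q)).subset ?_
  rintro x ⟨hx, h⟩
  simp only [Set.mem_ofPred_eq, dotProduct_sub, dotProduct_smul, smul_eq_mul]
  linear_combination - heq x hx h

/-- A point inside a right angle at the centre of the disk but beyond all chords with ends on its
legs violates the Euclidean sentence. -/
theorem not_kleinModel_Eu : ¬ kleinModel.Eu := by
  intro h
  obtain ⟨⟨x, hx⟩, ⟨y, hy⟩, h₁, h₂, h₃⟩ := h ⟨![0, 0], by simp [openDisk]⟩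
    ⟨![1 / 2, 0], by norm_num [openDisk]⟩ ⟨![0, 1 / 2], by norm_num [openDisk]⟩
    ⟨![1 / 4, 1 / 4], by norm_num [openDisk]⟩ ⟨![3 / 5, 3 / 5], by norm_num [openDisk]⟩
    ⟨wbtw_iff_exists_add_smul.2 ⟨5 / 12, by norm_num, by norm_num, by norm_num⟩,
      wbtw_iff_exists_add_smul.2 ⟨1 / 2, by norm_num, by norm_num, by norm_num⟩, by simp⟩
  obtain ⟨s, -, -, hs⟩ := wbtw_iff_exists_add_smul.1 h₁
  obtain ⟨r, -, -, hr⟩ := wbtw_iff_exists_add_smul.1 h₂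
  obtain ⟨u, hu₀, hu₁, hu⟩ := wbtw_iff_exists_add_smul.1 h₃
  have hs₀ := congrFun hs 0
  have hs₁ := congrFun hs 1
  have hr₀ := congrFun hr 0
  have hr₁ := congrFun hr 1
  have hu₂ := congrFun hu 0
  have hu₃ := congrFun hu 1
  simp at hs₀ hs₁ hr₀ hr₁ hu₂ hu₃
  have hx₁ : x 1 = 0 := hs₁.resolve_left fun h => by simp [h] at hs₀
  have hy₀ : y 0 = 0 := hr₀.resolve_left fun h => by simp [h] at hr₁
  have hlt : ∀ v ∈ openDisk, ∀ i, v i ≤ 1 := fun v hv i => by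
    simp only [openDisk, Set.mem_ofPred_eq, dotProduct, Fin.sum_univ_two] at hv
    fin_cases i <;> simp <;> nlinarith [sq_nonneg (v 0), sq_nonneg (v 1)]
  rw [hy₀] at hu₂
  rw [hx₁] at hu₃
  nlinarith [mul_nonneg (sub_nonneg.2 hu₁) (sub_nonneg.2 (hlt x hx 0)),
    mul_nonneg hu₀ (sub_nonneg.2 (hlt y hy 1))]

theorem independentIn_Eu : TarskiAx.Eu.IndependentIn CE₂' := by
  have : Nonempty openDisk := ⟨⟨0, by simp [openDisk]⟩⟩
  refine .of_model kleinModel (fun ψ hψ => ?_) not_kleinModel_Eu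
  cases ψ
  · exact convexModel_TE
  · exact kleinModel_IE
  · exact kleinModel_SC
  · exact kleinModel_FS'
  · exact convexModel_IB
  · exact convexModel_Pa convex_openDisk
  · exact kleinModel_Lo₂
  · exact kleinModel_Up₂
  · exact absurd rfl hψ
  · exact convexModel_Co convex_openDisk

theorem mainTheorem6 :
    TarskiAx.SC.IndependentIn CE₂' ∧
    TarskiAx.IB.IndependentIn CE₂' ∧
    TarskiAx.Lo₂.IndependentIn CE₂' ∧
    TarskiAx.Up₂.IndependentIn CE₂' ∧
    TarskiAx.Eu.IndependentIn CE₂' ∧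
    TarskiAx.Co.IndependentIn CE₂' :=
  ⟨independentIn_SC, independentIn_IB, independentIn_Lo₂, independentIn_Up₂, independentIn_Eu,
    independentIn_Co⟩
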